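/- Let $n\in\mathbb N$, let $Q>0$ be a real number, and let $\{e_k\}_{k=1}^n$ be the canonical orthonormal basis of $\mathbb C^n$. For a complex $n^2\times n^2$ matrix $T$, acting on $\mathbb C^n\otimes\mathbb C^n$, put $T_{12}=T\otimes I_n$ and $T_{23}=I_n\otimes T$, and consider the relations $$(\mathrm{T1})\ T^*=T,\qquad (\mathrm{T2})\ T\,T=Q\,T,\qquad (\mathrm{T3})\ T_{12}T_{23}T_{12}=T_{12},\qquad (\mathrm{T4})\ T_{23}T_{12}T_{23}=T_{23},$$ which say that $T$ determines a unitary tensor space representation of the Temperley--Lieb algebra $TL_N(Q)$ on $(\mathbb C^n)^{\otimes N}$. Fix any permutation $\sigma\in\mathcal S_n$ with $\sigma^{-1}=\sigma$ that has at most one fixed point. Then a complex $n^2\times n^2$ matrix $T$ has rank one and satisfies (T1)--(T4) if and only if there exist a unitary matrix $g\in U(n)$ and numbers $z_1,\dots,z_n\in\mathbb C\setminus\{0\}$ with $$\sum_{k=1}^n |z_k|^2=1,\qquad z_k\,z_{\sigma(k)}=Q^{-1}\quad\text{for all }k,$$ such that $$T=Q\,(g\otimes g)\,(v\otimes v^*)\,(g^*\otimes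 g^*),\qquad v=\sum_{k=1}^n z_k\,e_k\otimes e_{\sigma(k)},$$ where $v\otimes v^*$ is the rank-one matrix given by the column $v$ times the row $v^*$. -/

import Mathlib

open scoped Kronecker

noncomputable section

namespace TLRankOne

/-- `T₁₂ = T ⊗ I_n`, acting on `(ℂⁿ ⊗ ℂⁿ) ⊗ ℂⁿ`. Here `M_{n²}` is the ring of matrices indexed
by `Fin n × Fin n`, which indexes the canonical basis `e_a ⊗ e_b` of `ℂⁿ ⊗ ℂⁿ`. -/
def leg12 {n : ℕ} (T : Matrix (Fin n × Fin n) (Fin n × Fin n) ℂ) :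
    Matrix ((Fin n × Fin n) × Fin n) ((Fin n × Fin n) × Fin n) ℂ :=
  T ⊗ₖ (1 : Matrix (Fin n) (Fin n) ℂ)

/-- `T₂₃ = I_n ⊗ T`, transported from `ℂⁿ ⊗ (ℂⁿ ⊗ ℂⁿ)` to `(ℂⁿ ⊗ ℂⁿ) ⊗ ℂⁿ` along the
canonical identification of the index sets. -/
def leg23 {n : ℕ} (T : Matrix (Fin n × Fin n) (Fin n × Fin n) ℂ) :
    Matrix ((Fin n × Fin n) × Fin n) ((Fin n × Fin n) × Fin n) ℂ :=
  Matrix.reindex (Equiv.prodAssoc (Fin n) (Fin n) (Fin n)).symm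
    (Equiv.prodAssoc (Fin n) (Fin n) (Fin n)).symm
    ((1 : Matrix (Fin n) (Fin n) ℂ) ⊗ₖ T)

/-- The relations (T1)–(T4): `T` determines a unitary tensor space representation of the
Temperley–Lieb algebra with parameter `Q`. -/
structure IsTLSolution {n : ℕ} (Q : ℝ) (T : Matrix (Fin n × Fin n) (Fin n × Fin n) ℂ) :
    Prop where
  t1 : T.conjTranspose = T
  t2 : T * T = (Q : ℂ) • T
  t3 : leg12 T * leg23 T * leg12 T = leg12 T
  t4 : leg23 T * leg12 T * leg23 T = leg23 T

/-- The Kronecker product `x ⊗ y` of two vectors of `ℂⁿ`. -/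
def tensorVec {n : ℕ} (x y : Fin n → ℂ) : Fin n × Fin n → ℂ :=
  fun p => x p.1 * y p.2

/-- The vector `v = ∑ₖ zₖ eₖ ⊗ e_{σ(k)}`, where `eₖ` is the canonical basis of `ℂⁿ`. -/
def permVec {n : ℕ} (σ : Equiv.Perm (Fin n)) (z : Fin n → ℂ) : Fin n × Fin n → ℂ :=
  ∑ k, z k • tensorVec (Pi.single k 1) (Pi.single (σ k) 1)

end TLRankOne

end

/-! A rank-one `T` with (T1), (T2) is `Q w w*` for a unit vector `w`. Let `A` be the coefficient
matrix of `w` and `Ā` its entrywise conjugate, written `Aᵀᴴ`. The maps `x ↦ w ⊗ x` and `x ↦ x ⊗ w`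
are isometries whose products with their ranges' adjoints give `T₁₂` and `T₂₃` up to `Q`, so (T3)
and (T4) both say that `Q A Ā` is unitary (`isTLSolution_iff`).

Replacing `w` by `(g ⊗ g) w` replaces `A` by `g A gᵀ`, so what is needed is a normal form under
unitary congruence. This is a change of orthonormal basis for the antilinear map `J x = A x̄`, whose
square is `A Ā`. The required basis satisfies `J e_{σ(k)} = z_k e_k`. It is built by splitting off
reducing planes on which `J` swaps two orthogonal lines (`exists_swapped_pair`), one for each
2-cycle of `σ`; a last line serves the fixed point, if any (`exists_permuted_family`). -/

namespace TLRankOne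

open scoped ComplexConjugate InnerProductSpace

/-! ### Antilinear maps whose square is a multiple of a unitary. -/

section Antilinear

variable {V : Type*} [NormedAddCommGroup V] [InnerProductSpace ℂ V]

/-- `J` is an antilinear map with antilinear adjoint `J'` whose square is `c` times a unitary. -/
structure IsScaledUnitarySquare (c : ℝ) (J J' : V →ₗ⋆[ℂ] V) : Prop where
  pos : 0 < c
  adj : ∀ x y, ⟪J x, y⟫_ℂ = ⟪J' y, x⟫_ℂ
  adj_sq_sq : ∀ x, J' (J' (J (J x))) = ((c : ℂ) ^ 2) • x
  sq_adj_sq : ∀ x, J (J (J' (J' x))) = ((c : ℂ) ^ 2) • x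

/-- `e` is a unit vector that is an eigenvector of both `J J'` and `J²`. -/
structure IsJointEigenvector (J J' : V →ₗ⋆[ℂ] V) (h ν : ℂ) (e : V) : Prop where
  norm : ‖e‖ = 1
  eig_mod : J (J' e) = h • e
  eig_sq : J (J e) = ν • e

namespace IsScaledUnitarySquare

variable {c : ℝ} {J J' : V →ₗ⋆[ℂ] V}

theorem sq_ne_zero (hJ : IsScaledUnitarySquare c J J') : (c : ℂ) ^ 2 ≠ 0 := by
  have := hJ.pos.ne'
  exact pow_ne_zero _ (by exact_mod_cast this)

theorem eq_zero_of_map (hJ : IsScaledUnitarySquare c J J') {x : V} (h : J x = 0) : x = 0 := by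
  have := hJ.adj_sq_sq x
  rw [h] at this
  simp only [map_zero] at this
  exact (smul_eq_zero.1 this.symm).resolve_left hJ.sq_ne_zero

theorem injective (hJ : IsScaledUnitarySquare c J J') : Function.Injective J := fun x y h =>
  sub_eq_zero.1 (hJ.eq_zero_of_map (by rw [map_sub, h, sub_self]))

theorem adj' (hJ : IsScaledUnitarySquare c J J') (x y : V) : ⟪J' x, y⟫_ℂ = ⟪J y, x⟫_ℂ :=
  (hJ.adj y x).symm

theorem symm (hJ : IsScaledUnitarySquare c J J') : IsScaledUnitarySquare c J' J :=
  ⟨hJ.pos, hJ.adj', hJ.sq_adj_sq, hJ.adj_sq_sq⟩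

theorem adj_mul_self_mul_self_mul_adj (hJ : IsScaledUnitarySquare c J J') (x : V) :
    J' (J (J (J' x))) = ((c : ℂ) ^ 2) • x := by
  apply hJ.symm.injective
  rw [hJ.adj_sq_sq, LinearMap.map_smulₛₗ]
  simp

/-- Applying the injective `J'` turns both sides into `c² x`. Consequently `J J'` commutes with
`J²`, which is what makes joint eigenvectors available. -/
theorem sq_adj (hJ : IsScaledUnitarySquare c J J') (x : V) : J (J (J' x)) = J' (J (J x)) := by
  apply hJ.symm.injective
  rw [hJ.adj_sq_sq, hJ.adj_mul_self_mul_self_mul_adj]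

theorem norm_sq (hJ : IsScaledUnitarySquare c J J') (x : V) : ‖J (J x)‖ = c * ‖x‖ := by
  have h : ⟪J (J x), J (J x)⟫_ℂ = (c : ℂ) ^ 2 * ⟪x, x⟫_ℂ := by
    rw [hJ.adj, ← inner_conj_symm, hJ.adj, hJ.adj_sq_sq, inner_smul_left, map_mul,
      inner_conj_symm, Complex.conj_conj]
  rw [inner_self_eq_norm_sq_to_K, inner_self_eq_norm_sq_to_K] at h
  have h' : ‖J (J x)‖ ^ 2 = (c * ‖x‖) ^ 2 := by
    rw [mul_pow]
    simp only [Complex.coe_algebraMap] at h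
    exact_mod_cast h
  exact (sq_eq_sq₀ (norm_nonneg _) (mul_nonneg hJ.pos.le (norm_nonneg _))).1 h'

section Eigen

variable {h ν : ℂ} {e : V}

theorem norm_eig_sq (hJ : IsScaledUnitarySquare c J J') (he : IsJointEigenvector J J' h ν e) :
    ‖ν‖ = c := by
  have := hJ.norm_sq e
  rwa [he.eig_sq, norm_smul, he.norm, mul_one, mul_one] at this

theorem eig_sq_ne_zero (hJ : IsScaledUnitarySquare c J J')
    (he : IsJointEigenvector J J' h ν e) : ν ≠ 0 := by
  rw [← norm_ne_zero_iff, hJ.norm_eig_sq he]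
  exact hJ.pos.ne'

theorem eig_mod_eq (hJ : IsScaledUnitarySquare c J J') (he : IsJointEigenvector J J' h ν e) :
    h = ((‖J' e‖ ^ 2 : ℝ) : ℂ) := by
  have h1 : ⟪J (J' e), e⟫_ℂ = conj h := by
    rw [he.eig_mod, inner_smul_left, inner_self_eq_norm_sq_to_K, he.norm]
    simp
  rw [hJ.adj, inner_self_eq_norm_sq_to_K] at h1
  have h2 := congrArg conj h1
  simp only [Complex.conj_conj] at h2
  rw [← h2]
  simp

/-- `J` sends both sides to `h e`. So `J` and `J'` map `e` into the same line, and the span of `e`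
and `J e` will be reducing. -/
theorem adj_eigen (hJ : IsScaledUnitarySquare c J J') (he : IsJointEigenvector J J' h ν e) :
    J' e = conj (h / ν) • J e := by
  apply hJ.injective
  rw [he.eig_mod, LinearMap.map_smulₛₗ, he.eig_sq, smul_smul]
  simp [div_mul_cancel₀ _ (hJ.eig_sq_ne_zero he)]

theorem adj_mul_eigen (hJ : IsScaledUnitarySquare c J J') (he : IsJointEigenvector J J' h ν e) :
    h • J' (J e) = (c : ℂ) ^ 2 • e := by
  rw [← hJ.adj_mul_self_mul_self_mul_adj e, he.eig_mod]
  simp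

theorem eig_mod_ne_zero (hJ : IsScaledUnitarySquare c J J')
    (he : IsJointEigenvector J J' h ν e) : h ≠ 0 := by
  rintro rfl
  have := hJ.adj_mul_eigen he
  rw [zero_smul] at this
  have h1 := (smul_eq_zero.1 this.symm).resolve_left hJ.sq_ne_zero
  have := he.norm
  simp [h1] at this

/-- By the adjunction, `⟪J e, e⟫ = ⟪J' e, e⟫ = (h / ν) ⟪J e, e⟫`, so `h = ν`; moreover `h ≥ 0` and
`‖ν‖ = c`. -/
theorem eigenvalues_of_not_orthogonal (hJ : IsScaledUnitarySquare c J J')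
    (he : IsJointEigenvector J J' h ν e) (hne : ⟪J e, e⟫_ℂ ≠ 0) : h = c ∧ ν = c := by
  have h1 := hJ.adj e e
  rw [hJ.adj_eigen he, inner_smul_left, Complex.conj_conj] at h1
  have h2 : h = ν := by
    have := (mul_eq_right₀ hne).1 h1.symm
    exact (div_eq_one_iff_eq (hJ.eig_sq_ne_zero he)).1 this
  have h3 := hJ.norm_eig_sq he
  have h4 := hJ.eig_mod_eq he
  rw [← h2, h4, Complex.norm_real, Real.norm_of_nonneg (by positivity)] at h3
  rw [h3] at h4
  exact ⟨h4, h2 ▸ h4⟩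

end Eigen

end IsScaledUnitarySquare

theorem exists_eigenvector_mem [FiniteDimensional ℂ V] (f : V →ₗ[ℂ] V) (W : Submodule ℂ V)
    (hW : W ≠ ⊥) (hf : ∀ x ∈ W, f x ∈ W) : ∃ x ∈ W, x ≠ 0 ∧ ∃ μ : ℂ, f x = μ • x := by
  have : Nontrivial W := (Submodule.nontrivial_iff_ne_bot).2 hW
  obtain ⟨μ, hμ⟩ := Module.End.exists_eigenvalue (f.restrict hf)
  obtain ⟨x, hx⟩ := hμ.exists_hasEigenvector
  refine ⟨x, x.2, fun h => hx.2 (Subtype.ext h), μ, ?_⟩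
  have := congrArg Subtype.val hx.apply_eq_smul
  simpa using this

namespace IsScaledUnitarySquare

variable {c : ℝ} {J J' : V →ₗ⋆[ℂ] V} [FiniteDimensional ℂ V]

theorem exists_jointEigenvector (hJ : IsScaledUnitarySquare c J J') (W : Submodule ℂ V)
    (hW : W ≠ ⊥) (h1 : ∀ x ∈ W, J (J' x) ∈ W) (h2 : ∀ x ∈ W, J (J x) ∈ W) :
    ∃ e ∈ W, ∃ h ν, IsJointEigenvector J J' h ν e := by
  obtain ⟨x, hxW, hx0, h, hx⟩ := exists_eigenvector_mem (J.comp J') W hW h1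
  have hW' : W ⊓ LinearMap.ker (J.comp J' - h • LinearMap.id) ≠ ⊥ := by
    intro hb
    have : x ∈ W ⊓ LinearMap.ker (J.comp J' - h • LinearMap.id) := by
      simp only [LinearMap.comp_apply] at hx
      simp [hxW, hx]
    rw [hb] at this
    exact hx0 (by simpa using this)
  obtain ⟨y, hy, hy0, ν, hyν⟩ := exists_eigenvector_mem (J.comp J) _ hW' (by
    rintro y ⟨hyW, hy⟩
    refine ⟨h2 y hyW, ?_⟩
    have hy' : J (J' y) = h • y := by simpa [sub_eq_zero] using hy
    have : J (J' (J (J y))) = h • J (J y) := by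
      rw [← hJ.sq_adj, hy']
      simp
    simp [this])
  have hyh : J (J' y) = h • y := by simpa [sub_eq_zero] using hy.2
  simp only [LinearMap.comp_apply] at hyν
  refine ⟨((‖y‖⁻¹ : ℝ) : ℂ) • y, W.smul_mem _ hy.1, h, ν, ?_, ?_, ?_⟩
  · rw [norm_smul]
    simp [hy0]
  · simp [hyh, smul_comm h]
  · simp [hyν, smul_comm ν]

/-- If two orthogonal joint eigenvectors both fail, they share the eigenvalues `h = ν = c`, so every
combination is again a joint eigenvector, and a suitable one is orthogonal to its image. -/
theorem exists_jointEigenvector_orthogonal (hJ : IsScaledUnitarySquare c J J')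
    (W : Submodule ℂ V) (h2 : 2 ≤ Module.finrank ℂ W) (hW : ∀ x ∈ W, J x ∈ W)
    (hW' : ∀ x ∈ W, J' x ∈ W) :
    ∃ e ∈ W, ∃ h ν, IsJointEigenvector J J' h ν e ∧ ⟪J e, e⟫_ℂ = 0 := by
  obtain ⟨e₁, he₁W, h₁, ν₁, he₁⟩ := hJ.exists_jointEigenvector W
    (by rintro rfl; simp at h2) (fun x hx => hW _ (hW' _ hx)) (fun x hx => hW _ (hW _ hx))
  by_cases ho₁ : ⟪J e₁, e₁⟫_ℂ = 0
  · exact ⟨e₁, he₁W, h₁, ν₁, he₁, ho₁⟩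
  have hne₁ : e₁ ≠ 0 := by rintro rfl; simpa using he₁.norm
  have hdim := Submodule.finrank_add_inf_finrank_orthogonal
    (K₁ := ℂ ∙ e₁) (K₂ := W) (by simpa using he₁W)
  rw [finrank_span_singleton hne₁] at hdim
  obtain ⟨e₂, he₂W, h₂, ν₂, he₂⟩ := hJ.exists_jointEigenvector ((ℂ ∙ e₁)ᗮ ⊓ W)
    (by
      intro hb
      rw [hb, finrank_bot] at hdim
      omega)
    (by
      rintro x ⟨hx, hxW⟩
      refine ⟨?_, hW _ (hW' _ hxW)⟩
      rw [SetLike.mem_coe, Submodule.mem_orthogonal_singleton_iff_inner_left] at hx ⊢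
      rw [hJ.adj, ← inner_conj_symm, hJ.adj', he₁.eig_mod, inner_smul_left, ← inner_conj_symm, hx]
      simp)
    (by
      rintro x ⟨hx, hxW⟩
      refine ⟨?_, hW _ (hW _ hxW)⟩
      rw [SetLike.mem_coe, Submodule.mem_orthogonal_singleton_iff_inner_left] at hx ⊢
      -- `J²` is `c` times a unitary, so its eigenvector `e₁` is also one of the adjoint `J'²`;
      -- hence `J²` preserves the complement of `e₁`.
      have h3 : ν₁ • J' (J' e₁) = conj (conj ((c : ℂ) ^ 2)) • e₁ := by
        have := hJ.adj_sq_sq e₁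
        rw [he₁.eig_sq] at this
        simpa using this
      have h4 : ⟪ν₁ • J' (J' e₁), x⟫_ℂ = 0 := by
        rw [h3, inner_smul_left, ← inner_conj_symm, hx]
        simp
      rw [inner_smul_left] at h4
      have h5 := (mul_eq_zero.1 h4).resolve_left
        (by simpa using hJ.eig_sq_ne_zero he₁)
      rw [hJ.adj, ← inner_conj_symm, hJ.adj, h5, map_zero])
  by_cases ho₂ : ⟪J e₂, e₂⟫_ℂ = 0
  · exact ⟨e₂, he₂W.2, h₂, ν₂, he₂, ho₂⟩
  obtain ⟨rfl, rfl⟩ := hJ.eigenvalues_of_not_orthogonal he₁ ho₁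
  obtain ⟨rfl, rfl⟩ := hJ.eigenvalues_of_not_orthogonal he₂ ho₂
  -- With `x = e₁ + t e₂`, the antilinearity of `J` cancels that of the first slot: `⟪J x, x⟫` is a
  -- polynomial of degree two in `t`, free of `conj t`, and has a root.
  obtain ⟨s, hs⟩ := IsAlgClosed.exists_eq_mul_self
    (discrim ⟪J e₂, e₂⟫_ℂ (⟪J e₁, e₂⟫_ℂ + ⟪J e₂, e₁⟫_ℂ) ⟪J e₁, e₁⟫_ℂ)
  obtain ⟨t, ht⟩ := exists_quadratic_eq_zero ho₂ ⟨s, hs⟩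
  have horth : ⟪e₂, e₁⟫_ℂ = 0 :=
    (Submodule.mem_orthogonal_singleton_iff_inner_left).1 he₂W.1
  have hx0 : e₁ + t • e₂ ≠ 0 := by
    intro h0
    have : ⟪e₁ + t • e₂, e₁⟫_ℂ = 0 := by rw [h0, inner_zero_left]
    rw [inner_add_left, inner_smul_left, horth, mul_zero, add_zero] at this
    exact hne₁ (inner_self_eq_zero.1 this)
  refine ⟨((‖e₁ + t • e₂‖⁻¹ : ℝ) : ℂ) • (e₁ + t • e₂),
    W.smul_mem _ (W.add_mem he₁W (W.smul_mem _ he₂W.2)), c, c, ⟨?_, ?_, ?_⟩, ?_⟩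
  · rw [norm_smul]
    simp [hx0]
  · simp only [LinearMap.map_smulₛₗ, map_add, he₁.eig_mod, he₂.eig_mod, Complex.conj_conj]
    module
  · simp only [LinearMap.map_smulₛₗ, map_add, he₁.eig_sq, he₂.eig_sq, Complex.conj_conj]
    module
  · rw [LinearMap.map_smulₛₗ, inner_smul_left, inner_smul_right, map_add, LinearMap.map_smulₛₗ,
      inner_add_left, inner_add_right, inner_add_right, inner_smul_left, inner_smul_left,
      inner_smul_right, inner_smul_right, Complex.conj_conj, Complex.conj_conj]
    have : ⟪J e₁, e₁⟫_ℂ + t * ⟪J e₁, e₂⟫_ℂ + (t * ⟪J e₂, e₁⟫_ℂ + t * (t * ⟪J e₂, e₂⟫_ℂ)) = 0 := by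
      rw [← ht]
      ring
    rw [this]
    simp

end IsScaledUnitarySquare

end Antilinear

/-! ### Orthonormal normal form of the antilinear map. -/

section NormalForm

variable {V : Type*} [NormedAddCommGroup V] [InnerProductSpace ℂ V] [FiniteDimensional ℂ V]
  {c : ℝ} {J J' : V →ₗ⋆[ℂ] V}

theorem exists_norm_eq_one_sq_eq {w : ℂ} (hw : ‖w‖ = 1) : ∃ β : ℂ, ‖β‖ = 1 ∧ β ^ 2 = w := by
  obtain ⟨β, hβ⟩ := IsAlgClosed.exists_pow_nat_eq w (n := 2) (by norm_num)
  refine ⟨β, ?_, hβ⟩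
  have : ‖β‖ ^ 2 = 1 := by rw [← norm_pow, hβ, hw]
  exact (pow_eq_one_iff_of_nonneg (norm_nonneg _) two_ne_zero).1 this

namespace IsScaledUnitarySquare

theorem exists_swapped_pair (hJ : IsScaledUnitarySquare c J J') (W : Submodule ℂ V)
    (h2 : 2 ≤ Module.finrank ℂ W) (hW : ∀ x ∈ W, J x ∈ W) (hW' : ∀ x ∈ W, J' x ∈ W) :
    ∃ e ∈ W, ∃ f ∈ W, ∃ z z' : ℂ, ‖e‖ = 1 ∧ ‖f‖ = 1 ∧ ⟪e, f⟫_ℂ = 0 ∧ z * z' = c ∧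
      J e = z • f ∧ J f = z' • e ∧ (∃ t : ℂ, J' e = t • f) ∧ ∃ t : ℂ, J' f = t • e := by
  obtain ⟨e, heW, h, ν, he, ho⟩ := hJ.exists_jointEigenvector_orthogonal W h2 hW hW'
  have hne : e ≠ 0 := by rintro rfl; simpa using he.norm
  have hr : ‖J e‖ ≠ 0 := norm_ne_zero_iff.2 fun h0 => hne (hJ.eq_zero_of_map h0)
  have hc : (c : ℂ) ≠ 0 := by exact_mod_cast hJ.pos.ne'
  have hν := hJ.norm_eig_sq he
  -- With `f = J e / ‖J e‖` the product `z z'` is `ν`. Multiplying `f` by a phase `β` divides this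
  -- product by `β²`, so `β² = ν / c` makes it `c`.
  obtain ⟨β, hβ, hβ2⟩ := exists_norm_eq_one_sq_eq (w := ν / c) (by
    rw [norm_div, hν, Complex.norm_real, Real.norm_of_nonneg hJ.pos.le, div_self hJ.pos.ne'])
  have hβ0 : β ≠ 0 := by rw [← norm_ne_zero_iff, hβ]; exact one_ne_zero
  have hββ : conj β * β = 1 := by rw [Complex.conj_mul', hβ]; simp
  set r : ℂ := ((‖J e‖ : ℝ) : ℂ) with hrdef
  have hr0 : r ≠ 0 := Complex.ofReal_ne_zero.2 hr
  have hrc : conj r = r := Complex.conj_ofReal _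
  have hJe : J e = (r / β) • ((β / r) • J e) := by
    rw [smul_smul, div_mul_div_cancel₀ hβ0, div_self hr0, one_smul]
  refine ⟨e, heW, (β / r) • J e, W.smul_mem _ (hW _ heW), r / β, conj β / r * ν, he.norm, ?_, ?_,
    ?_, hJe, ?_, ⟨conj (h / ν) * (r / β), ?_⟩, ⟨conj β / r * ((c : ℂ) ^ 2 / h), ?_⟩⟩
  · rw [norm_smul, norm_div, hβ, hrdef, Complex.norm_real, norm_norm, one_div,
      inv_mul_cancel₀ hr]
  · rw [inner_smul_right, ← inner_conj_symm, ho, map_zero, mul_zero]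
  · have h1 : ν = β ^ 2 * c := by rw [hβ2, div_mul_cancel₀ _ hc]
    calc r / β * (conj β / r * ν) = conj β * β * c := by
          rw [h1]
          field_simp
      _ = c := by rw [hββ, one_mul]
  · rw [LinearMap.map_smulₛₗ, he.eig_sq, smul_smul, map_div₀, hrc]
  · rw [mul_smul, ← hJe]
    exact hJ.adj_eigen he
  · have h0 := hJ.eig_mod_ne_zero he
    have h1 : J' (J e) = ((c : ℂ) ^ 2 / h) • e := by
      rw [div_eq_inv_mul, mul_smul, ← hJ.adj_mul_eigen he, smul_smul, inv_mul_cancel₀ h0, one_smul]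
    rw [LinearMap.map_smulₛₗ, h1, smul_smul, map_div₀, hrc]

theorem exists_fixed_line (hJ : IsScaledUnitarySquare c J J') (W : Submodule ℂ V)
    (h1 : Module.finrank ℂ W = 1) (hW : ∀ x ∈ W, J x ∈ W) :
    ∃ e ∈ W, ∃ z : ℂ, ‖e‖ = 1 ∧ z * z = c ∧ J e = z • e := by
  obtain ⟨⟨e₀, he₀W⟩, he₀, hspan⟩ := finrank_eq_one_iff'.1 h1
  have he₀0 : e₀ ≠ 0 := fun h => he₀ (Subtype.ext h)
  obtain ⟨a, ha⟩ := hspan ⟨J e₀, hW _ he₀W⟩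
  have ha' : J e₀ = a • e₀ := (congrArg Subtype.val ha).symm
  have hn : ‖a‖ * ‖a‖ = c := by
    have := hJ.norm_sq e₀
    rw [ha', LinearMap.map_smulₛₗ, ha', norm_smul, norm_smul, ← mul_assoc] at this
    have := mul_right_cancel₀ (norm_ne_zero_iff.2 he₀0) this
    simpa using this
  have ha0 : ‖a‖ ≠ 0 := fun h => hJ.pos.ne' (by rw [← hn, h, mul_zero])
  have ha0' : (‖a‖ : ℂ) ≠ 0 := by exact_mod_cast ha0
  -- Multiplying `e₀` by a phase `β` divides the coefficient `a` by `β²`; this choice makes it the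
  -- positive number `‖a‖`.
  obtain ⟨β, hβ, hβ2⟩ := exists_norm_eq_one_sq_eq (w := a / ‖a‖) (by
    rw [norm_div, Complex.norm_real, norm_norm, div_self ha0])
  have hββ : conj β * β = 1 := by rw [Complex.conj_mul', hβ]; simp
  have h2 : a = β ^ 2 * ‖a‖ := by rw [hβ2, div_mul_cancel₀ _ ha0']
  refine ⟨(β / (‖e₀‖ : ℂ)) • e₀, W.smul_mem _ he₀W, ‖a‖, ?_, ?_, ?_⟩
  · rw [norm_smul, norm_div, hβ, Complex.norm_real, norm_norm, one_div,
      inv_mul_cancel₀ (norm_ne_zero_iff.2 he₀0)]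
  · rw [← hn]; push_cast; rfl
  · rw [LinearMap.map_smulₛₗ, ha', smul_smul, smul_smul, map_div₀, Complex.conj_ofReal]
    congr 1
    calc conj β / (‖e₀‖ : ℂ) * a = (conj β * β) * (β * ‖a‖) / ‖e₀‖ := by
          nth_rewrite 1 [h2]
          ring
      _ = _ := by rw [hββ]; ring

/-- Induction on the `σ`-stable set `s`: a 2-cycle in `s` is matched with a swapped pair in `W`, and
the rest of `s` with the orthogonal complement of that pair. Once no point moves, `s` has at most
one element. -/
theorem exists_permuted_family {ι : Type*} [DecidableEq ι]
    (hJ : IsScaledUnitarySquare c J J') (σ : Equiv.Perm ι) (hσ : ∀ i, σ (σ i) = i)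
    (hfix : {k : ι | σ k = k}.Subsingleton) (s : Finset ι) :
    ∀ (_ : ∀ i ∈ s, σ i ∈ s) (W : Submodule ℂ V) (_ : Module.finrank ℂ W = s.card)
      (_ : ∀ x ∈ W, J x ∈ W) (_ : ∀ x ∈ W, J' x ∈ W),
    ∃ (e : ι → V) (z : ι → ℂ), (∀ i ∈ s, e i ∈ W ∧ ‖e i‖ = 1) ∧
      (∀ i ∈ s, ∀ j ∈ s, i ≠ j → ⟪e i, e j⟫_ℂ = 0) ∧
      ∀ i ∈ s, z i * z (σ i) = c ∧ J (e (σ i)) = z i • e i := by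
  induction s using Finset.strongInduction with
  | H s ih =>
    intro hs W hdim hW hW'
    by_cases hmove : ∃ k ∈ s, σ k ≠ k
    · obtain ⟨k, hk, hσk⟩ := hmove
      have hle : ({k, σ k} : Finset ι) ⊆ s := by
        intro i hi
        rcases Finset.mem_insert.1 hi with rfl | hi
        · exact hk
        · rw [Finset.mem_singleton.1 hi]; exact hs k hk
      have hcard2 : ({k, σ k} : Finset ι).card = 2 := Finset.card_pair (Ne.symm hσk)
      have hcard := Finset.card_sdiff_add_card_eq_card hle
      have hdim2 : 2 ≤ Module.finrank ℂ W := by omega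
      obtain ⟨a, haW, b, hbW, z₁, z₂, han, hbn, hab, hz, hJa, hJb, ⟨t₁, ht₁⟩, t₂, ht₂⟩ :=
        hJ.exists_swapped_pair W hdim2 hW hW'
      have hli : LinearIndependent ℂ ![a, b] := by
        have hba : ⟪b, a⟫_ℂ = 0 := by rw [← inner_conj_symm, hab, map_zero]
        have : Orthonormal ℂ ![a, b] := by
          constructor
          · intro i; fin_cases i <;> simp [han, hbn]
          · intro i j hij; fin_cases i <;> fin_cases j <;> simp_all
        exact this.linearIndependent
      have hspan : Module.finrank ℂ (Submodule.span ℂ (Set.range ![a, b])) = 2 := by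
        rw [finrank_span_eq_card hli, Fintype.card_fin]
      have hdim' := Submodule.finrank_add_inf_finrank_orthogonal
        (K₁ := Submodule.span ℂ (Set.range ![a, b])) (K₂ := W) (by
          rw [Submodule.span_le]
          rintro _ ⟨i, rfl⟩
          fin_cases i <;> simp [haW, hbW])
      set W₁ := (Submodule.span ℂ (Set.range ![a, b]))ᗮ ⊓ W with hW₁
      have hmem : ∀ x, x ∈ W₁ ↔ (⟪a, x⟫_ℂ = 0 ∧ ⟪b, x⟫_ℂ = 0) ∧ x ∈ W := by
        intro x
        rw [hW₁, Submodule.mem_inf]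
        refine and_congr_left fun _ => ⟨fun hx => ?_, fun hx => ?_⟩
        · exact ⟨hx a (Submodule.subset_span ⟨0, rfl⟩), hx b (Submodule.subset_span ⟨1, rfl⟩)⟩
        · rw [Submodule.mem_orthogonal']
          intro u hu
          induction hu using Submodule.span_induction with
          | mem u hu =>
            obtain ⟨i, rfl⟩ := hu
            rw [← inner_conj_symm]
            fin_cases i <;> simp [hx.1, hx.2]
          | zero => simp
          | add u v _ _ hu hv => rw [inner_add_right, hu, hv, add_zero]
          | smul r u _ hu => rw [inner_smul_right, hu, mul_zero]
      obtain ⟨e, z, heW, horth, hperm⟩ := ih (s \ {k, σ k})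
        (Finset.sdiff_ssubset hle ⟨k, by simp⟩)
        (by
          intro i hi
          simp only [Finset.mem_sdiff, Finset.mem_insert, Finset.mem_singleton, not_or] at hi ⊢
          refine ⟨hs i hi.1, fun h => hi.2.2 ?_, fun h => hi.2.1 (σ.injective h)⟩
          rw [← h, hσ])
        W₁ (by omega)
        -- `J'` maps each of `a`, `b` into the line of the other, so by adjunction `J` preserves
        -- their complement; the next block exchanges the roles of `J` and `J'`.
        (by
          intro x hx
          rw [hmem] at hx ⊢
          refine ⟨⟨?_, ?_⟩, hW _ hx.2⟩
          · rw [← inner_conj_symm, hJ.adj, ht₁, inner_smul_left, hx.1.2]; simp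
          · rw [← inner_conj_symm, hJ.adj, ht₂, inner_smul_left, hx.1.1]; simp)
        (by
          intro x hx
          rw [hmem] at hx ⊢
          refine ⟨⟨?_, ?_⟩, hW' _ hx.2⟩
          · rw [← inner_conj_symm, hJ.adj', hJa, inner_smul_left, hx.1.2]; simp
          · rw [← inner_conj_symm, hJ.adj', hJb, inner_smul_left, hx.1.1]; simp)
      have hcase : ∀ i ∈ s, i = k ∨ i = σ k ∨ (i ≠ k ∧ i ≠ σ k ∧ i ∈ s \ {k, σ k}) := by
        intro i hi
        simp only [Finset.mem_sdiff, Finset.mem_insert, Finset.mem_singleton, not_or]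
        tauto
      have hba : ⟪b, a⟫_ℂ = 0 := by rw [← inner_conj_symm, hab, map_zero]
      -- The scalars are crossed because `z k` is the coefficient of `J (e (σ k)) = J b = z₂ a`.
      refine ⟨fun i => if i = k then a else if i = σ k then b else e i,
        fun i => if i = k then z₂ else if i = σ k then z₁ else z i, ?_, ?_, ?_⟩
      · intro i hi
        rcases hcase i hi with rfl | rfl | ⟨h1, h2, h3⟩
        · simp [haW, han]
        · simp [hσk, hbW, hbn]
        · simp [h1, h2, (heW i h3).2, ((hmem _).1 (heW i h3).1).2]
      · have key : ∀ i ∈ s \ {k, σ k}, ⟪a, e i⟫_ℂ = 0 ∧ ⟪b, e i⟫_ℂ = 0 ∧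
            ⟪e i, a⟫_ℂ = 0 ∧ ⟪e i, b⟫_ℂ = 0 := by
          intro i hi
          have h := ((hmem _).1 (heW i hi).1).1
          refine ⟨h.1, h.2, ?_, ?_⟩
          · rw [← inner_conj_symm, h.1, map_zero]
          · rw [← inner_conj_symm, h.2, map_zero]
        intro i hi j hj hij
        rcases hcase i hi with rfl | rfl | ⟨h1, h2, h3⟩ <;>
        rcases hcase j hj with rfl | rfl | ⟨h1', h2', h3'⟩
        · exact absurd rfl hij
        · simp [hσk, hab]
        · simp [h1', h2', key j h3']
        · simp [hσk, hba]
        · exact absurd rfl hij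
        · simp [hσk, h1', h2', key j h3']
        · simp [h1, h2, key i h3]
        · simp [h1, h2, hσk, key i h3]
        · simp [h1, h2, h1', h2', horth i h3 j h3' hij]
      · intro i hi
        rcases hcase i hi with rfl | rfl | ⟨h1, h2, h3⟩
        · simp [hσk, mul_comm z₂, hz, hJb]
        · simp [hσk, hσ, hz, hJa]
        · have h4 : σ i ≠ k := fun h => h2 (by rw [← h, hσ])
          have h5 : σ i ≠ σ k := fun h => h1 (σ.injective h)
          simp only [h1, h2, h4, h5, if_false]
          exact hperm i h3
    · push Not at hmove
      rcases s.eq_empty_or_nonempty with rfl | ⟨k, hk⟩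
      · exact ⟨fun _ => 0, fun _ => 0, by simp, by simp, by simp⟩
      · have hsk : s = {k} := Finset.eq_singleton_iff_unique_mem.2
          ⟨hk, fun i hi => hfix (hmove i hi) (hmove k hk)⟩
        subst hsk
        obtain ⟨e, heW, z, hen, hz, hJe⟩ := hJ.exists_fixed_line W (by simpa using hdim) hW
        have hkk := hmove k hk
        refine ⟨fun _ => e, fun _ => z, by simp [heW, hen], ?_, by simp [hz, hJe]⟩
        intro i hi j hj hij
        exact absurd ((Finset.mem_singleton.1 hi).trans (Finset.mem_singleton.1 hj).symm) hij

end IsScaledUnitarySquare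

end NormalForm

open Matrix

/-! ### Self-adjoint matrices of rank one. -/

section RankOne

variable {ι : Type*} [Fintype ι]

theorem star_dotProduct_self (x : ι → ℂ) : star x ⬝ᵥ x = ((∑ i, ‖x i‖ ^ 2 : ℝ) : ℂ) := by
  simp [dotProduct, Complex.conj_mul']

theorem rank_smul_vecMulVec [DecidableEq ι] {a : ℂ} (ha : a ≠ 0) {w : ι → ℂ}
    (hw : star w ⬝ᵥ w = 1) :
    (a • vecMulVec w (star w)).rank = 1 := by
  have h1 : (a • vecMulVec w (star w)).rank ≤ 1 := by
    rw [← smul_vecMulVec]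
    exact rank_vecMulVec_le _ _
  have h0 : (a • vecMulVec w (star w)).rank ≠ 0 := by
    intro h
    have h2 := LinearMap.congr_fun (LinearMap.range_eq_bot.1 (Submodule.finrank_eq_zero.1 h)) w
    simp only [mulVecLin_apply, smul_mulVec, vecMulVec_mulVec, hw, LinearMap.zero_apply] at h2
    have hw0 : w = 0 := by simpa [ha] using h2
    simp [hw0] at hw
  omega

theorem exists_eq_vecMulVec_of_rank_eq_one [DecidableEq ι] {T : Matrix ι ι ℂ} (h : T.rank = 1) :
    ∃ x y, T = vecMulVec x y := by
  obtain ⟨⟨x, hx⟩, -, hspan⟩ := finrank_eq_one_iff'.1 h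
  choose y hy using fun j => hspan ⟨T *ᵥ Pi.single j 1, ⟨_, rfl⟩⟩
  refine ⟨x, y, ?_⟩
  ext i j
  have := congrFun (congrArg Subtype.val (hy j)) i
  simp only [mulVec_single_one, SetLike.val_smul, Pi.smul_apply, smul_eq_mul] at this
  rw [vecMulVec_apply, mul_comm, this]
  rfl

theorem exists_unit_vector_of_rank_eq_one [DecidableEq ι] {T : Matrix ι ι ℂ} {Q : ℝ}
    (h : T.rank = 1) (hT : Tᴴ = T) (hTT : T * T = (Q : ℂ) • T) :
    ∃ w : ι → ℂ, star w ⬝ᵥ w = 1 ∧ T = (Q : ℂ) • vecMulVec w (star w) := by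
  obtain ⟨x, y, rfl⟩ := exists_eq_vecMulVec_of_rank_eq_one h
  have hT0 : vecMulVec x y ≠ 0 := by
    intro h0
    rw [h0, rank_zero] at h
    exact zero_ne_one h
  have hx0 : x ≠ 0 := by
    rintro rfl
    simp at hT0
  have hyx : y ⬝ᵥ x = Q := by
    have : (y ⬝ᵥ x) • vecMulVec x y = (Q : ℂ) • vecMulVec x y := by
      rw [← hTT, vecMulVec_mul_vecMulVec]
      ext i j
      simp [vecMulVec_apply, mul_left_comm]
    exact smul_left_injective _ hT0 this
  set r : ℝ := ∑ i, ‖x i‖ ^ 2 with hr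
  have hxx : star x ⬝ᵥ x = r := star_dotProduct_self x
  have hr0 : 0 < r := by
    have hne : r ≠ 0 := by
      intro h0
      apply hx0
      ext i
      have := (Finset.sum_eq_zero_iff_of_nonneg fun i _ => by positivity).1 (hr.symm.trans h0) i
        (Finset.mem_univ i)
      simpa using this
    exact lt_of_le_of_ne (Finset.sum_nonneg fun i _ => by positivity) hne.symm
  have hrC : (r : ℂ) ≠ 0 := by exact_mod_cast hr0.ne'
  -- Multiplying `T* = T` on the left by the row `x*` makes `y` proportional to `x*`.
  have hy : (r : ℂ) • y = (Q : ℂ) • star x := by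
    have h1 := congrArg (fun M => star x ᵥ* M) hT
    rw [conjTranspose_vecMulVec] at h1
    simp only [vecMul_vecMulVec, hxx] at h1
    rw [← h1]
    have : star x ⬝ᵥ star y = Q := by
      rw [star_dotProduct_star, hyx]
      simp
    rw [this]
  have hsq : ((Real.sqrt r : ℝ) : ℂ) * ((Real.sqrt r : ℝ) : ℂ) = r := by
    rw [← Complex.ofReal_mul, Real.mul_self_sqrt hr0.le]
  have hs0 : ((Real.sqrt r : ℝ) : ℂ) ≠ 0 := fun h0 => hrC (by rw [← hsq, h0, mul_zero])
  set s : ℂ := ((Real.sqrt r : ℝ) : ℂ) with hs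
  have hstar : star s⁻¹ = s⁻¹ := by simp [hs]
  refine ⟨s⁻¹ • x, ?_, ?_⟩
  · rw [star_smul, smul_dotProduct, dotProduct_smul, hxx, hstar, ← hsq]
    simp only [smul_eq_mul]
    field_simp
  · have hy' : y = (Q / r : ℂ) • star x := by
      rw [div_eq_inv_mul, mul_smul, ← hy, smul_smul, inv_mul_cancel₀ hrC, one_smul]
    rw [star_smul, hstar, hy']
    ext i j
    simp only [vecMulVec_apply, Matrix.smul_apply, Pi.smul_apply, smul_eq_mul, ← hsq]
    field_simp

end RankOne

/-! ### The Temperley–Lieb relations as a matrix equation. -/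

variable {n : ℕ}

/-- The `n × n` matrix of coefficients of a vector of `ℂⁿ ⊗ ℂⁿ`. -/
def coeffMatrix (w : Fin n × Fin n → ℂ) : Matrix (Fin n) (Fin n) ℂ :=
  of fun i j => w (i, j)

/-- The map `x ↦ w ⊗ x`. -/
def leftLeg (w : Fin n × Fin n → ℂ) : Matrix ((Fin n × Fin n) × Fin n) (Fin n) ℂ :=
  of fun p d => w p.1 * (1 : Matrix (Fin n) (Fin n) ℂ) p.2 d

/-- The map `x ↦ x ⊗ w`. -/
def rightLeg (w : Fin n × Fin n → ℂ) : Matrix ((Fin n × Fin n) × Fin n) (Fin n) ℂ :=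
  of fun p d => (1 : Matrix (Fin n) (Fin n) ℂ) p.1.1 d * w (p.1.2, p.2)

theorem leg12_smul_vecMulVec (a : ℂ) (w : Fin n × Fin n → ℂ) :
    leg12 (a • vecMulVec w (star w)) = a • (leftLeg w * (leftLeg w)ᴴ) := by
  ext ⟨p, c⟩ ⟨p', c'⟩
  by_cases h : c = c' <;>
    simp [leg12, leftLeg, mul_apply, vecMulVec_apply, one_apply, apply_ite, h]

theorem leg23_smul_vecMulVec (a : ℂ) (w : Fin n × Fin n → ℂ) :
    leg23 (a • vecMulVec w (star w)) = a • (rightLeg w * (rightLeg w)ᴴ) := by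
  ext ⟨⟨i, j⟩, k⟩ ⟨⟨i', j'⟩, k'⟩
  by_cases h : i = i' <;>
    simp [leg23, rightLeg, mul_apply, vecMulVec_apply, one_apply, apply_ite, h]

theorem conjTranspose_leftLeg_mul_leftLeg {w : Fin n × Fin n → ℂ} (hw : star w ⬝ᵥ w = 1) :
    (leftLeg w)ᴴ * leftLeg w = 1 := by
  ext d d'
  have : ∑ i, ∑ j, star (w (i, j)) * w (i, j) = 1 := by
    rw [← hw, dotProduct, Fintype.sum_prod_type]
    rfl
  obtain rfl | h := eq_or_ne d' d
  · simp_all [leftLeg, mul_apply, one_apply, apply_ite, Fintype.sum_prod_type]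
  · simp [leftLeg, mul_apply, one_apply, apply_ite, Fintype.sum_prod_type, h, h.symm]

theorem conjTranspose_rightLeg_mul_rightLeg {w : Fin n × Fin n → ℂ} (hw : star w ⬝ᵥ w = 1) :
    (rightLeg w)ᴴ * rightLeg w = 1 := by
  ext d d'
  have : ∑ i, ∑ j, star (w (i, j)) * w (i, j) = 1 := by
    rw [← hw, dotProduct, Fintype.sum_prod_type]
    rfl
  obtain rfl | h := eq_or_ne d' d
  · simp_all [rightLeg, mul_apply, one_apply, apply_ite, Fintype.sum_prod_type]
  · simp [rightLeg, mul_apply, one_apply, apply_ite, Fintype.sum_prod_type, h, h.symm]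

theorem conjTranspose_leftLeg_mul_rightLeg (w : Fin n × Fin n → ℂ) :
    (leftLeg w)ᴴ * rightLeg w = (coeffMatrix w * (coeffMatrix w)ᵀᴴ)ᴴ := by
  ext d d'
  simp [leftLeg, rightLeg, coeffMatrix, mul_apply, one_apply, apply_ite, Fintype.sum_prod_type,
    mul_comm]

/-- With isometries `X`, `Y` and `Y* X = N`, the triple products collapse to `Q³ X N* N X*` and `Q³
Y N N* Y*`. For square `N`, `Q² N* N = 1` and `Q² N N* = 1` are equivalent, so (T3) already forces
(T4). -/
theorem isTLSolution_iff {Q : ℝ} (hQ : 0 < Q) {w : Fin n × Fin n → ℂ} (hw : star w ⬝ᵥ w = 1) :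
    IsTLSolution Q ((Q : ℂ) • vecMulVec w (star w)) ↔
      ((Q : ℂ) ^ 2) • ((coeffMatrix w * (coeffMatrix w)ᵀᴴ)ᴴ *
        (coeffMatrix w * (coeffMatrix w)ᵀᴴ)) = 1 := by
  have hQ0 : (Q : ℂ) ≠ 0 := by exact_mod_cast hQ.ne'
  set X := leftLeg w with hX
  set Y := rightLeg w with hY
  set N := coeffMatrix w * (coeffMatrix w)ᵀᴴ with hN
  have hXX : Xᴴ * X = 1 := conjTranspose_leftLeg_mul_leftLeg hw
  have hYY : Yᴴ * Y = 1 := conjTranspose_rightLeg_mul_rightLeg hw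
  have hXY : Xᴴ * Y = Nᴴ := conjTranspose_leftLeg_mul_rightLeg w
  have hYX : Yᴴ * X = N := by
    rw [← conjTranspose_conjTranspose N, ← hXY, conjTranspose_mul, conjTranspose_conjTranspose]
  have e1 : leg12 ((Q : ℂ) • vecMulVec w (star w)) * leg23 ((Q : ℂ) • vecMulVec w (star w)) *
      leg12 ((Q : ℂ) • vecMulVec w (star w)) =
        (Q : ℂ) • (X * (((Q : ℂ) ^ 2) • (Nᴴ * N)) * Xᴴ) := by
    rw [leg12_smul_vecMulVec, leg23_smul_vecMulVec, ← hX, ← hY]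
    calc _ = (Q * (Q * Q) : ℂ) • (X * ((Xᴴ * Y) * (Yᴴ * X)) * Xᴴ) := by
          simp only [Matrix.smul_mul, Matrix.mul_smul, smul_smul, Matrix.mul_assoc]
      _ = _ := by
          rw [hXY, hYX]
          simp only [Matrix.smul_mul, Matrix.mul_smul, smul_smul, pow_two]
  have e2 : leg23 ((Q : ℂ) • vecMulVec w (star w)) * leg12 ((Q : ℂ) • vecMulVec w (star w)) *
      leg23 ((Q : ℂ) • vecMulVec w (star w)) =
        (Q : ℂ) • (Y * (((Q : ℂ) ^ 2) • (N * Nᴴ)) * Yᴴ) := by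
    rw [leg12_smul_vecMulVec, leg23_smul_vecMulVec, ← hX, ← hY]
    calc _ = (Q * (Q * Q) : ℂ) • (Y * ((Yᴴ * X) * (Xᴴ * Y)) * Yᴴ) := by
          simp only [Matrix.smul_mul, Matrix.mul_smul, smul_smul, Matrix.mul_assoc]
      _ = _ := by
          rw [hXY, hYX]
          simp only [Matrix.smul_mul, Matrix.mul_smul, smul_smul, pow_two]
  constructor
  · intro h
    have h3 := h.t3
    rw [e1, leg12_smul_vecMulVec, ← hX] at h3
    have h4 := smul_right_injective _ hQ0 h3
    calc ((Q : ℂ) ^ 2) • (Nᴴ * N)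
        = (Xᴴ * X) * (((Q : ℂ) ^ 2) • (Nᴴ * N)) * (Xᴴ * X) := by
          rw [hXX, Matrix.one_mul, Matrix.mul_one]
      _ = Xᴴ * (X * (((Q : ℂ) ^ 2) • (Nᴴ * N)) * Xᴴ) * X := by simp only [Matrix.mul_assoc]
      _ = (Xᴴ * X) * (Xᴴ * X) := by
          rw [show X * (((Q : ℂ) ^ 2) • (Nᴴ * N)) * Xᴴ = X * Xᴴ from h4]
          simp only [Matrix.mul_assoc]
      _ = 1 := by rw [hXX, Matrix.one_mul]
  · intro h
    have h' : ((Q : ℂ) ^ 2) • (N * Nᴴ) = 1 := by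
      rw [← mul_smul_comm, ← mul_eq_one_comm, smul_mul_assoc, h]
    refine ⟨?_, ?_, ?_, ?_⟩
    · rw [conjTranspose_smul, conjTranspose_vecMulVec, star_star]
      simp
    · rw [smul_mul_smul_comm, vecMulVec_mul_vecMulVec, hw, one_smul, mul_smul]
    · rw [e1, h, Matrix.mul_one, leg12_smul_vecMulVec]
    · rw [e2, h', Matrix.mul_one, leg23_smul_vecMulVec]

/-! ### From coefficient matrices to antilinear maps. -/

/-- The antilinear map `x ↦ A x̄` on `ℂⁿ`. -/
def conjMap (A : Matrix (Fin n) (Fin n) ℂ) :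
    EuclideanSpace ℂ (Fin n) →ₗ⋆[ℂ] EuclideanSpace ℂ (Fin n) where
  toFun x := WithLp.toLp 2 (A *ᵥ star x.ofLp)
  map_add' x y := by simp [mulVec_add]
  map_smul' a x := by simp [mulVec_smul]

theorem conjMap_apply (A : Matrix (Fin n) (Fin n) ℂ) (x : EuclideanSpace ℂ (Fin n)) :
    conjMap A x = WithLp.toLp 2 (A *ᵥ star x.ofLp) := rfl

theorem conjMap_conjMap (A B : Matrix (Fin n) (Fin n) ℂ) (x : EuclideanSpace ℂ (Fin n)) :
    conjMap A (conjMap B x) = WithLp.toLp 2 ((A * Bᵀᴴ) *ᵥ x.ofLp) := by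
  rw [conjMap_apply, conjMap_apply, ← mulVec_mulVec, star_mulVec, star_star, ← mulVec_transpose]
  rfl

theorem isScaledUnitarySquare_conjMap {Q : ℝ} (hQ : 0 < Q) {A : Matrix (Fin n) (Fin n) ℂ}
    (hA : ((Q : ℂ) ^ 2) • ((A * Aᵀᴴ)ᴴ * (A * Aᵀᴴ)) = 1) :
    IsScaledUnitarySquare Q⁻¹ (conjMap A) (conjMap Aᵀ) := by
  have hQ0 : (Q : ℂ) ≠ 0 := by exact_mod_cast hQ.ne'
  have hA' : ((Q : ℂ) ^ 2) • ((A * Aᵀᴴ) * (A * Aᵀᴴ)ᴴ) = 1 := by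
    rw [← mul_smul_comm, ← mul_eq_one_comm, smul_mul_assoc, hA]
  have hadj : (A * Aᵀᴴ)ᴴ = Aᵀ * Aᵀᵀᴴ := by
    rw [conjTranspose_mul, conjTranspose_conjTranspose, transpose_transpose]
  have key : ∀ M : Matrix (Fin n) (Fin n) ℂ, ((Q : ℂ) ^ 2) • M = 1 →
      M = (((Q⁻¹ : ℝ) : ℂ) ^ 2) • (1 : Matrix (Fin n) (Fin n) ℂ) := by
    intro M hM
    rw [← hM, smul_smul, Complex.ofReal_inv, ← mul_pow, inv_mul_cancel₀ hQ0, one_pow, one_smul]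
  refine ⟨inv_pos.2 hQ, ?_, ?_, ?_⟩
  · intro x y
    rw [EuclideanSpace.inner_eq_star_dotProduct, EuclideanSpace.inner_eq_star_dotProduct,
      conjMap_apply, conjMap_apply, star_mulVec, star_mulVec, star_star, star_star,
      ← mulVec_transpose Aᵀᴴ, dotProduct_comm, ← dotProduct_mulVec]
    rfl
  · intro x
    rw [conjMap_conjMap, conjMap_conjMap, mulVec_mulVec, ← hadj, key _ hA, smul_mulVec, one_mulVec]
    rfl
  · intro x
    rw [conjMap_conjMap, conjMap_conjMap, mulVec_mulVec, ← hadj, key _ hA', smul_mulVec,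
      one_mulVec]
    rfl

/-! ### Permutation vectors and unitary congruence. -/

theorem permVec_apply (σ : Equiv.Perm (Fin n)) (z : Fin n → ℂ) (i j : Fin n) :
    permVec σ z (i, j) = if j = σ i then z i else 0 := by
  simp only [permVec, tensorVec, Finset.sum_apply, Pi.smul_apply, smul_eq_mul, Pi.single_apply]
  rw [Finset.sum_eq_single i]
  · simp
  · intro b _ hb
    simp [hb.symm]
  · simp

theorem star_permVec_dotProduct_permVec (σ : Equiv.Perm (Fin n)) (z : Fin n → ℂ) :
    star (permVec σ z) ⬝ᵥ permVec σ z = ((∑ k, ‖z k‖ ^ 2 : ℝ) : ℂ) := by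
  rw [star_dotProduct_self, Fintype.sum_prod_type]
  simp [permVec_apply, apply_ite]

theorem coeffMatrix_kronecker_mulVec (g : Matrix (Fin n) (Fin n) ℂ) (v : Fin n × Fin n → ℂ) :
    coeffMatrix ((g ⊗ₖ g) *ᵥ v) = g * coeffMatrix v * gᵀ := by
  ext i j
  simp only [coeffMatrix, of_apply, mulVec, dotProduct, Fintype.sum_prod_type, mul_apply,
    kroneckerMap_apply, transpose_apply, Finset.sum_mul]
  rw [Finset.sum_comm]
  exact Finset.sum_congr rfl fun _ _ => Finset.sum_congr rfl fun _ _ => by ring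

theorem coeffMatrix_injective : Function.Injective (coeffMatrix (n := n)) := fun v w h => by
  ext ⟨i, j⟩
  exact congrFun (congrFun h i) j

theorem kronecker_mul_vecMulVec_mul (g : Matrix (Fin n) (Fin n) ℂ) (v : Fin n × Fin n → ℂ) :
    (g ⊗ₖ g) * vecMulVec v (star v) * (gᴴ ⊗ₖ gᴴ) =
      vecMulVec ((g ⊗ₖ g) *ᵥ v) (star ((g ⊗ₖ g) *ᵥ v)) := by
  rw [mul_vecMulVec, vecMulVec_mul, star_mulVec, conjTranspose_kronecker]

theorem star_kronecker_mulVec_dotProduct {g : Matrix (Fin n) (Fin n) ℂ} (hg : gᴴ * g = 1)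
    (v : Fin n × Fin n → ℂ) :
    star ((g ⊗ₖ g) *ᵥ v) ⬝ᵥ ((g ⊗ₖ g) *ᵥ v) = star v ⬝ᵥ v := by
  rw [star_mulVec, ← dotProduct_mulVec, mulVec_mulVec, conjTranspose_kronecker,
    ← mul_kronecker_mul, hg, one_kronecker_one, one_mulVec]

theorem coeffMatrix_permVec_mul (σ : Equiv.Perm (Fin n)) (hσ : ∀ i, σ (σ i) = i)
    (z : Fin n → ℂ) :
    coeffMatrix (permVec σ z) * (coeffMatrix (permVec σ z))ᵀᴴ =
      diagonal fun k => z k * star (z (σ k)) := by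
  ext i j
  simp only [mul_apply, conjTranspose_apply, transpose_apply, coeffMatrix, of_apply, permVec_apply]
  rw [Finset.sum_eq_single (σ i)]
  · by_cases h : i = j <;> simp [hσ, h, Ne.symm]
  · intro b _ hb
    simp [hb]
  · simp

/-- Unitary congruence of `A` is unitary conjugation of `A Ā`, which becomes `g D g*`; the diagonal
entries `z_k conj(z_{σ(k)})` of `D` have modulus `|z_k z_{σ(k)}| = 1 / Q`. -/
theorem unitary_square_of_permVec {Q : ℝ} (hQ : 0 < Q) (σ : Equiv.Perm (Fin n))
    (hσ : ∀ i, σ (σ i) = i) {z : Fin n → ℂ} (hz : ∀ k, z k * z (σ k) = ((Q⁻¹ : ℝ) : ℂ))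
    {g : Matrix (Fin n) (Fin n) ℂ} (hg : gᴴ * g = 1) {A : Matrix (Fin n) (Fin n) ℂ}
    (hA : A = g * coeffMatrix (permVec σ z) * gᵀ) :
    ((Q : ℂ) ^ 2) • ((A * Aᵀᴴ)ᴴ * (A * Aᵀᴴ)) = 1 := by
  have hg' : g * gᴴ = 1 := mul_eq_one_comm.1 hg
  have hgt : gᵀ * gᵀᴴ = 1 := by
    have := congrArg transpose hg
    rwa [transpose_mul, transpose_one] at this
  set D : Matrix (Fin n) (Fin n) ℂ := diagonal fun k => z k * star (z (σ k)) with hD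
  have hN : A * Aᵀᴴ = g * D * gᴴ := by
    rw [hD, ← coeffMatrix_permVec_mul σ hσ, hA]
    calc _ = g * coeffMatrix (permVec σ z) * (gᵀ * gᵀᴴ) * (coeffMatrix (permVec σ z))ᵀᴴ * gᴴ := by
          simp only [transpose_mul, conjTranspose_mul, transpose_transpose, Matrix.mul_assoc]
      _ = _ := by
          rw [hgt]
          simp only [Matrix.mul_assoc, Matrix.one_mul]
  have hDD : ((Q : ℂ) ^ 2) • (Dᴴ * D) = 1 := by
    rw [hD, diagonal_conjTranspose, diagonal_mul_diagonal]
    ext i j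
    rw [Matrix.smul_apply, diagonal_apply, one_apply]
    split_ifs with h
    · have h1 : star (z i * star (z (σ i))) * (z i * star (z (σ i))) =
          (z i * z (σ i)) * star (z i * z (σ i)) := by
        simp only [star_mul, star_star]
        ring
      simp only [Pi.star_apply, smul_eq_mul]
      rw [h1, hz]
      have hQ0 : (Q : ℂ) ≠ 0 := by exact_mod_cast hQ.ne'
      simp
      field_simp
    · simp
  rw [hN]
  calc _ = ((Q : ℂ) ^ 2) • (g * (Dᴴ * ((gᴴ * g) * (D * gᴴ)))) := by
        simp only [conjTranspose_mul, conjTranspose_conjTranspose, Matrix.mul_assoc]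
    _ = g * (((Q : ℂ) ^ 2) • (Dᴴ * D)) * gᴴ := by
        rw [hg, Matrix.one_mul]
        simp only [Matrix.smul_mul, Matrix.mul_smul, Matrix.mul_assoc]
    _ = 1 := by rw [hDD, Matrix.mul_one, hg']

theorem exists_unitary_congruence {Q : ℝ} (hQ : 0 < Q) (σ : Equiv.Perm (Fin n))
    (hσ : ∀ i, σ (σ i) = i) (hfix : {k : Fin n | σ k = k}.Subsingleton)
    {A : Matrix (Fin n) (Fin n) ℂ} (hA : ((Q : ℂ) ^ 2) • ((A * Aᵀᴴ)ᴴ * (A * Aᵀᴴ)) = 1) :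
    ∃ g : Matrix (Fin n) (Fin n) ℂ, gᴴ * g = 1 ∧ ∃ z : Fin n → ℂ,
      (∀ k, z k * z (σ k) = ((Q⁻¹ : ℝ) : ℂ)) ∧ A = g * coeffMatrix (permVec σ z) * gᵀ := by
  obtain ⟨e, z, hnorm, horth, hperm⟩ :=
    (isScaledUnitarySquare_conjMap hQ hA).exists_permuted_family σ hσ hfix Finset.univ
      (by simp) ⊤ (by simp) (by simp) (by simp)
  simp only [Finset.mem_univ, forall_true_left, Submodule.mem_top, true_and] at hnorm horth hperm
  set g : Matrix (Fin n) (Fin n) ℂ := of fun i k => e k i with hg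
  have hgg : gᴴ * g = 1 := by
    ext k l
    have h1 : (gᴴ * g) k l = ⟪e k, e l⟫_ℂ := by
      rw [EuclideanSpace.inner_eq_star_dotProduct, dotProduct_comm]
      rfl
    rw [h1, one_apply]
    split_ifs with h
    · rw [h, inner_self_eq_norm_sq_to_K, hnorm]
      simp
    · exact horth k l h
  have hgt : gᵀᴴ * gᵀ = 1 := by
    have := congrArg transpose (mul_eq_one_comm.1 hgg)
    rwa [transpose_mul, transpose_one] at this
  refine ⟨g, hgg, z, fun k => (hperm k).1, ?_⟩
  -- Since the columns of `g` are the `e_k`, the columns of `A ḡ` are the vectors `J e_l`, to which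
  -- `J e_{σ(k)} = z_k e_k` applies with `k = σ(l)`.
  have hmul : A * gᵀᴴ = g * coeffMatrix (permVec σ z) := by
    ext i l
    have h2 := congrArg (fun x : EuclideanSpace ℂ (Fin n) => x i) (hperm (σ l)).2
    rw [hσ] at h2
    have h3 : (A * gᵀᴴ) i l = z (σ l) * e (σ l) i := h2
    rw [h3, mul_apply]
    simp only [coeffMatrix, of_apply, permVec_apply, hg]
    rw [Finset.sum_eq_single (σ l)]
    · simp [hσ, mul_comm]
    · intro b _ hb
      rw [if_neg, mul_zero]
      rintro rfl
      exact hb (hσ b).symm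
    · simp
  rw [← hmul, Matrix.mul_assoc, hgt, Matrix.mul_one]

end TLRankOne

theorem mainTheorem2 (n : ℕ) (σ : Equiv.Perm (Fin n)) (hσ : σ⁻¹ = σ)
    (hfix : {k : Fin n | σ k = k}.Subsingleton) (Q : ℝ) (hQ : 0 < Q)
    (T : Matrix (Fin n × Fin n) (Fin n × Fin n) ℂ) :
    (T.rank = 1 ∧ TLRankOne.IsTLSolution Q T) ↔
      ∃ g ∈ Matrix.unitaryGroup (Fin n) ℂ, ∃ z : Fin n → ℂ,
        (∀ k, z k ≠ 0) ∧ (∑ k, ‖z k‖ ^ 2 = 1) ∧ (∀ k, z k * z (σ k) = ((Q⁻¹ : ℝ) : ℂ)) ∧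
        T = (Q : ℂ) •
          ((g ⊗ₖ g) *
            Matrix.vecMulVec (TLRankOne.permVec σ z) (star (TLRankOne.permVec σ z)) *
            (g.conjTranspose ⊗ₖ g.conjTranspose)) := by
  have hσσ : ∀ i, σ (σ i) = i := fun i => by
    nth_rewrite 1 [← hσ]
    exact σ.symm_apply_apply i
  have hQ0 : (Q : ℂ) ≠ 0 := by exact_mod_cast hQ.ne'
  constructor
  · rintro ⟨hrank, hT⟩
    obtain ⟨w, hw, rfl⟩ := TLRankOne.exists_unit_vector_of_rank_eq_one hrank hT.t1 hT.t2
    obtain ⟨g, hg, z, hz, hA⟩ := TLRankOne.exists_unitary_congruence hQ σ hσσ hfix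
      ((TLRankOne.isTLSolution_iff hQ hw).1 hT)
    rw [← TLRankOne.coeffMatrix_kronecker_mulVec] at hA
    have hwv := TLRankOne.coeffMatrix_injective hA
    refine ⟨g, Matrix.mem_unitaryGroup_iff'.2 hg, z, ?_, ?_, hz, ?_⟩
    · intro k h0
      have := hz k
      rw [h0, zero_mul] at this
      exact (inv_pos.2 hQ).ne (Complex.ofReal_injective this)
    · rw [hwv, TLRankOne.star_kronecker_mulVec_dotProduct hg,
        TLRankOne.star_permVec_dotProduct_permVec] at hw
      exact_mod_cast hw
    · rw [TLRankOne.kronecker_mul_vecMulVec_mul, ← hwv]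
  · rintro ⟨g, hgU, z, -, hsum, hz, rfl⟩
    have hg : g.conjTranspose * g = 1 := Matrix.mem_unitaryGroup_iff'.1 hgU
    rw [TLRankOne.kronecker_mul_vecMulVec_mul]
    set w := Matrix.mulVec (g ⊗ₖ g) (TLRankOne.permVec σ z) with hwdef
    have hw : dotProduct (star w) w = 1 := by
      rw [hwdef, TLRankOne.star_kronecker_mulVec_dotProduct hg,
        TLRankOne.star_permVec_dotProduct_permVec, hsum, Complex.ofReal_one]
    exact ⟨TLRankOne.rank_smul_vecMulVec hQ0 hw, (TLRankOne.isTLSolution_iff hQ hw).2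
      (TLRankOne.unitary_square_of_permVec hQ σ hσσ hz hg
        (TLRankOne.coeffMatrix_kronecker_mulVec g _))⟩
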